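/- Fix a countably infinite set of propositional variables and consider formulas over the signature $\{\land,\lor,\neg,\circ,\bot,\top\}$. Write $A^T:=\circ A\land A$ and $A^F:=\circ A\land\neg A$. The logic $LET_F^+$ (expanded with $\top,\bot$) is given by the natural deduction system consisting of - the rules of $FDE$: introduction and elimination of $\land$ and of $\lor$; from $\neg A$, or from $\neg B$, infer $\neg(A\land B)$, and the elimination of $\neg(A\land B)$ by cases $[\neg A]$, $[\neg B]$; from $\neg A$ and $\neg B$ infer $\neg(A\lor B)$, and from $\neg(A\lor B)$ infer $\neg A$ and infer $\neg B$; $A$ and $\neg\neg A$ are inferred from each other; - from $\circ A$, $A$, $\neg A$ infer any $B$; from $\circ A$ infer $A\lor\neg A$; - the axiom $\circ\circ A$; $\circ A$ and $\circ\neg A$ are inferred from each other; - from $A^T,B^T$ infer $(A\land B)^T$; from $(A\land B)^T$ infer $A^T$ and infer $B^T$; from $A^F$, or from $B^F$, infer $(A\land B)^F$; elimination of $(A\land B)^F$ by cases $[A^F]$, $[B^F]$; - from $A^T$, or from $B^T$, infer $(A\lor B)^T$; elimination of $(A\lor B)^T$ by cases $[A^T]$, $[B^T]$; from $A^F,B^F$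 infer $(A\lor B)^F$; from $(A\lor B)^F$ infer $A^F$ and infer $B^F$; - for the constants (definable as $\circ\circ p$ and $\neg\circ\circ p$), the axioms $\top^T$ and $\bot^F$. $\Gamma\vdash_{LET_F^+}A$ means that there is a deduction of $A$ from premises in $\Gamma$. An involutive Stone algebra is a De Morgan algebra with a unary operator $\nabla$ such that $\nabla\bot=\bot$, $x\land\nabla x=x$, $\nabla(x\land y)=\nabla x\land\nabla y$ and $\neg\nabla x\land\nabla x=\bot$. These algebras are presented in the signature $\{\land,\lor,\neg,\circ,\bot,\top\}$ through $\circ x=\neg\nabla x\lor\neg\nabla\neg x$ and $\nabla x=x\lor\neg\circ x$; let $\mathbb{ISA}$ be the variety so presented. Let $\mathbb S_6$ be the involutive Stone algebra whose lattice is $F<F_0<\mathsf b,\mathsf n<T_0<T$ ($\mathsf b,\mathsf n$ incomparable), with $\neg$ exchanging $T,F$ and $T_0,F_0$ and fixing $\mathsf b,\mathsf n$, with $\nabla F=F$ and $\nabla a=T$ for $a\ne F$ (so $\circ a=T$ for $a\in\{T,F\}$ and $\circ a=F$ otherwise). For a class $K$ of such algebras, $\Gamma\models^{\le}_{K}A$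 means: either $v(A)=\top$ for every valuation $v$ over every algebra in $K$, or there are $n\ge1$ and $A_1,\dots,A_n\in\Gamma$ such that $v(A_1)\land\dots\land v(A_n)\le v(A)$ for every valuation $v$ over every algebra in $K$. **Proposition.** $LET_F^+$ coincides with the logic preserving degrees of truth of the variety of involutive Stone algebras: for every set $\Gamma$ of formulas and every formula $A$, $$\Gamma\vdash_{LET_F^+}A\iff\Gamma\models^{\le}_{\mathbb{ISA}}A,\qquad\text{and also}\qquad \Gamma\vdash_{LET_F^+}A\iff\Gamma\models^{\le}_{\{\mathbb S_6\}}A .$$ -/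

import Mathlib

universe u v

/-! Formulas over the signature `{∧, ∨, ¬, ∘, ⊥, ⊤}`, with propositional variables in `V`. -/

/-- The formulas freely generated by the variables in `V` over `{∧, ∨, ¬, ∘, ⊥, ⊤}`. -/
inductive LFormula (V : Type v) : Type v
  | var : V → LFormula V
  | top : LFormula V
  | bot : LFormula V
  | neg : LFormula V → LFormula V
  | circ : LFormula V → LFormula V
  | and : LFormula V → LFormula V → LFormula V
  | or : LFormula V → LFormula V → LFormula V

namespace LFormula

/-- `A^T := ∘A ∧ A`. -/
def markT {V : Type v} (A : LFormula V) : LFormula V := and (circ A) A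

/-- `A^F := ∘A ∧ ¬A`. -/
def markF {V : Type v} (A : LFormula V) : LFormula V := and (circ A) (neg A)

end LFormula

open LFormula in
/-- Natural deduction for the logic `LET_F^+` in the signature with `⊤` and `⊥`:
`LetfDerives Γ A` says that there is a deduction of `A` from the set of premises `Γ`. A rule that
discharges a hypothesis `H` has a premise in which `H` is added to the set of hypotheses. -/
inductive LetfDerives {V : Type v} : Set (LFormula V) → LFormula V → Prop
  | hyp {Γ A} : A ∈ Γ → LetfDerives Γ A
  /- Rules of `FDE`. -/
  | andI {Γ A B} : LetfDerives Γ A → LetfDerives Γ B → LetfDerives Γ (and A B)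
  | andE₁ {Γ A B} : LetfDerives Γ (and A B) → LetfDerives Γ A
  | andE₂ {Γ A B} : LetfDerives Γ (and A B) → LetfDerives Γ B
  | orI₁ {Γ A B} : LetfDerives Γ A → LetfDerives Γ (or A B)
  | orI₂ {Γ A B} : LetfDerives Γ B → LetfDerives Γ (or A B)
  | orE {Γ A B C} : LetfDerives Γ (or A B) → LetfDerives (insert A Γ) C →
      LetfDerives (insert B Γ) C → LetfDerives Γ C
  | negAndI₁ {Γ A B} : LetfDerives Γ (neg A) → LetfDerives Γ (neg (and A B))
  | negAndI₂ {Γ A B} : LetfDerives Γ (neg B) → LetfDerives Γ (neg (and A B))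
  | negAndE {Γ A B C} : LetfDerives Γ (neg (and A B)) → LetfDerives (insert (neg A) Γ) C →
      LetfDerives (insert (neg B) Γ) C → LetfDerives Γ C
  | negOrI {Γ A B} : LetfDerives Γ (neg A) → LetfDerives Γ (neg B) →
      LetfDerives Γ (neg (or A B))
  | negOrE₁ {Γ A B} : LetfDerives Γ (neg (or A B)) → LetfDerives Γ (neg A)
  | negOrE₂ {Γ A B} : LetfDerives Γ (neg (or A B)) → LetfDerives Γ (neg B)
  | dnI {Γ A} : LetfDerives Γ A → LetfDerives Γ (neg (neg A))
  | dnE {Γ A} : LetfDerives Γ (neg (neg A)) → LetfDerives Γ A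
  /- Explosion and excluded middle for classical formulas. -/
  | expCirc {Γ A B} : LetfDerives Γ (circ A) → LetfDerives Γ A → LetfDerives Γ (neg A) →
      LetfDerives Γ B
  | pemCirc {Γ A} : LetfDerives Γ (circ A) → LetfDerives Γ (or A (neg A))
  /- The axiom `∘∘A` and propagation of classicality. -/
  | circI {Γ A} : LetfDerives Γ (circ (circ A))
  | negCircI {Γ A} : LetfDerives Γ (circ A) → LetfDerives Γ (circ (neg A))
  | negCircE {Γ A} : LetfDerives Γ (circ (neg A)) → LetfDerives Γ (circ A)
  | andTI {Γ A B} : LetfDerives Γ (markT A) → LetfDerives Γ (markT B) →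
      LetfDerives Γ (markT (and A B))
  | andFI₁ {Γ A B} : LetfDerives Γ (markF A) → LetfDerives Γ (markF (and A B))
  | andFI₂ {Γ A B} : LetfDerives Γ (markF B) → LetfDerives Γ (markF (and A B))
  | orTI₁ {Γ A B} : LetfDerives Γ (markT A) → LetfDerives Γ (markT (or A B))
  | orTI₂ {Γ A B} : LetfDerives Γ (markT B) → LetfDerives Γ (markT (or A B))
  | orFI {Γ A B} : LetfDerives Γ (markF A) → LetfDerives Γ (markF B) →
      LetfDerives Γ (markF (or A B))
  | andTE₁ {Γ A B} : LetfDerives Γ (markT (and A B)) → LetfDerives Γ (markT A)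
  | andTE₂ {Γ A B} : LetfDerives Γ (markT (and A B)) → LetfDerives Γ (markT B)
  | andFE {Γ A B C} : LetfDerives Γ (markF (and A B)) → LetfDerives (insert (markF A) Γ) C →
      LetfDerives (insert (markF B) Γ) C → LetfDerives Γ C
  | orTE {Γ A B C} : LetfDerives Γ (markT (or A B)) → LetfDerives (insert (markT A) Γ) C →
      LetfDerives (insert (markT B) Γ) C → LetfDerives Γ C
  | orFE₁ {Γ A B} : LetfDerives Γ (markF (or A B)) → LetfDerives Γ (markF A)
  | orFE₂ {Γ A B} : LetfDerives Γ (markF (or A B)) → LetfDerives Γ (markF B)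
  /- The constants: `⊤` is classically true (`⊤^T`) and `⊥` is classically false (`⊥^F`). These
  are the properties of the formulas `∘∘p` and `¬∘∘p`, by which the constants are definable. -/
  | topI {Γ} : LetfDerives Γ (markT top)
  | botI {Γ} : LetfDerives Γ (markF bot)

/-! Involutive Stone algebras. -/

/-- De Morgan algebras: bounded distributive lattices with an involution `ᶜ` satisfying the
De Morgan laws (one of which, with involutivity, gives the other). -/
class DeMorganAlg (M : Type u) extends DistribLattice M, BoundedOrder M, Compl M where
  invol : ∀ x : M, xᶜᶜ = x
  deMorgan : ∀ x y : M, (x ⊔ y)ᶜ = xᶜ ⊓ yᶜ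

/-- `nab` is an operator `∇` making a De Morgan algebra into an involutive Stone algebra. -/
structure IsNabla {M : Type u} [DeMorganAlg M] (nab : M → M) : Prop where
  map_bot : nab ⊥ = ⊥
  inf_self : ∀ x, x ⊓ nab x = x
  map_inf : ∀ x y, nab (x ⊓ y) = nab x ⊓ nab y
  compl_inf : ∀ x, (nab x)ᶜ ⊓ nab x = ⊥

/-- Involutive Stone algebras, in the signature `{∧, ∨, ¬, ∇, ⊥, ⊤}`. -/
class InvStoneAlg (M : Type u) extends DeMorganAlg M where
  nabla : M → M
  isNabla : IsNabla nabla

/-- Involutive Stone algebras presented in the signature `{∧, ∨, ¬, ∘, ⊥, ⊤}`: the operator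
`∇x := x ∨ ¬∘x` satisfies the equations of involutive Stone algebras, and `∘` is recovered from
it by `∘x = ¬∇x ∨ ¬∇¬x`. -/
class InvStoneCircAlg (M : Type u) extends DeMorganAlg M where
  circ : M → M
  isNabla : IsNabla (fun x : M => x ⊔ (circ x)ᶜ)
  circ_eq : ∀ x : M, circ x = (x ⊔ (circ x)ᶜ)ᶜ ⊔ (xᶜ ⊔ (circ xᶜ)ᶜ)ᶜ

/-- An algebra in the `∘`-presentation, seen in the `∇`-presentation. -/
abbrev InvStoneCircAlg.toNabla (M : Type u) [h : InvStoneCircAlg M] : InvStoneAlg M where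
  __ := h.toDeMorganAlg
  nabla := fun x => x ⊔ (circ x)ᶜ
  isNabla := h.isNabla

/-- In an involutive Stone algebra, `∇` is recovered from `∘x := ¬∇x ∨ ¬∇¬x` by
`∇x = x ∨ ¬∘x`. -/
theorem InvStoneAlg.nabla_eq {M : Type u} [InvStoneAlg M] (x : M) :
    x ⊔ ((nabla x)ᶜ ⊔ (nabla xᶜ)ᶜ)ᶜ = nabla x := by
  have inv := DeMorganAlg.invol (M := M)
  have dm := DeMorganAlg.deMorgan (M := M)
  have h := InvStoneAlg.isNabla (M := M)
  have antitone : ∀ {a b : M}, a ≤ b → bᶜ ≤ aᶜ := by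
    intro a b hab
    have := dm a b
    rw [sup_eq_right.2 hab] at this
    rw [this]
    exact inf_le_left
  have hbot : (⊥ : M)ᶜ = ⊤ := by
    have h1 : (⊤ : M)ᶜᶜ ≤ ⊥ᶜ := antitone bot_le
    rw [inv] at h1
    exact top_le_iff.1 h1
  have hx : xᶜ ≤ nabla xᶜ := inf_eq_left.1 (h.inf_self xᶜ)
  have hx' : (nabla xᶜ)ᶜ ≤ x := by simpa [inv] using antitone hx
  have hc : (nabla xᶜ)ᶜ ⊔ nabla xᶜ = ⊤ := by
    have h2 := inv ((nabla xᶜ)ᶜ ⊔ nabla xᶜ)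
    rw [dm, inv, inf_comm, h.compl_inf, hbot] at h2
    exact h2.symm
  have hone : x ⊔ nabla xᶜ = ⊤ := top_le_iff.1 (hc ▸ sup_le_sup_right hx' _)
  rw [dm, inv, inv, sup_inf_left, hone, inf_top_eq]
  exact sup_eq_right.2 (inf_eq_left.1 (h.inf_self x))

/-- An algebra in the `∇`-presentation, seen in the `∘`-presentation. -/
abbrev InvStoneAlg.toCirc (M : Type u) [h : InvStoneAlg M] : InvStoneCircAlg M where
  __ := h.toDeMorganAlg
  circ := fun x => (nabla x)ᶜ ⊔ (nabla xᶜ)ᶜ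
  isNabla := by
    have e : (fun x : M => x ⊔ ((nabla x)ᶜ ⊔ (nabla xᶜ)ᶜ)ᶜ) = nabla :=
      funext InvStoneAlg.nabla_eq
    rw [e]
    exact h.isNabla
  circ_eq := fun x => by rw [InvStoneAlg.nabla_eq x, InvStoneAlg.nabla_eq xᶜ]

/-! The six-element algebra. -/

/-- The six truth values. -/
inductive S6 : Type
  | T | T₀ | b | n | F₀ | F
  deriving DecidableEq

namespace S6

instance : Fintype S6 := ⟨{T, T₀, b, n, F₀, F}, fun x => by cases x <;> decide⟩

/-- Conjunction: the meet of the lattice `F < F₀ < b, n < T₀ < T`. -/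
def meet : S6 → S6 → S6
  | T, x => x
  | x, T => x
  | F, _ => F
  | _, F => F
  | T₀, x => x
  | x, T₀ => x
  | F₀, _ => F₀
  | _, F₀ => F₀
  | b, b => b
  | n, n => n
  | b, n => F₀
  | n, b => F₀

/-- Negation. -/
def opp : S6 → S6
  | T => F
  | T₀ => F₀
  | b => b
  | n => n
  | F₀ => T₀
  | F => T

/-- Disjunction. -/
def join (x y : S6) : S6 := opp (meet (opp x) (opp y))

/-- The operator `∇`. -/
def nab : S6 → S6
  | F => F
  | _ => T

/-- The operator `∘`. -/
def con : S6 → S6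
  | T => T
  | F => T
  | _ => F

instance : DeMorganAlg S6 where
  le x y := meet x y = x
  le_refl := by decide
  le_trans := by decide
  le_antisymm := by decide
  inf := meet
  sup := join
  le_sup_left := by decide
  le_sup_right := by decide
  sup_le := by decide
  inf_le_left := by decide
  inf_le_right := by decide
  le_inf := by decide
  le_sup_inf := by decide
  top := T
  le_top := by decide
  bot := F
  bot_le := by decide
  compl := opp
  invol := by decide
  deMorgan := by decide

instance : InvStoneCircAlg S6 where
  circ := con
  isNabla := ⟨by decide, by decide, by decide, by decide⟩
  circ_eq := by decide

/-- In `S6`, the operator `∇` of the `∘`-presentation is the usual one. -/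
theorem nab_eq (x : S6) : x ⊔ (InvStoneCircAlg.circ x)ᶜ = nab x := by
  revert x
  decide

end S6

/-! Degree-preserving consequence. -/

/-- The value of a formula in an algebra under an assignment of values to the variables. -/
def LFormula.eval {V : Type v} {M : Type u} [InvStoneCircAlg M] (w : V → M) : LFormula V → M
  | .var p => w p
  | .top => ⊤
  | .bot => ⊥
  | .neg A => (A.eval w)ᶜ
  | .circ A => InvStoneCircAlg.circ (A.eval w)
  | .and A B => A.eval w ⊓ B.eval w
  | .or A B => A.eval w ⊔ B.eval w

/-- The logic preserving degrees of truth of the variety of involutive Stone algebras (in the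
`∘`-presentation): either `A` takes the value `⊤` under all valuations over all the algebras, or
some nonempty finite set `Δ` of premises has `⋀ Δ ≤ A` under all valuations over all of them. -/
def IsaDegreeEntails {V : Type v} (Γ : Set (LFormula V)) (A : LFormula V) : Prop :=
  (∀ (M : Type u) [InvStoneCircAlg M] (w : V → M), A.eval w = ⊤) ∨
    ∃ Δ : Finset (LFormula V), Δ.Nonempty ∧ (∀ B ∈ Δ, B ∈ Γ) ∧
      ∀ (M : Type u) [InvStoneCircAlg M] (w : V → M), (Δ.inf fun B => B.eval w) ≤ A.eval w

/-- The logic preserving degrees of truth of the single algebra `S6`. -/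
def S6DegreeEntails {V : Type v} (Γ : Set (LFormula V)) (A : LFormula V) : Prop :=
  (∀ w : V → S6, A.eval w = ⊤) ∨
    ∃ Δ : Finset (LFormula V), Δ.Nonempty ∧ (∀ B ∈ Δ, B ∈ Γ) ∧
      ∀ w : V → S6, (Δ.inf fun B => B.eval w) ≤ A.eval w

/-! Structural properties of deductions. -/

namespace LetfDerives

variable {V : Type v} {Γ Δ : Set (LFormula V)} {A B C D : LFormula V}

/-! Three implications form a circle: derivability gives degree entailment over all involutive Stone
algebras, this gives it over `S6`, and that gives derivability.

Soundness rests on the identities `∘x ∧ x = ¬∇¬x` and `∘x ∧ ¬x = ¬∇x` (`circ_inf_self`,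
`circ_inf_compl`). Since `∇` preserves meets and joins (`IsNabla.map_sup`), the rules for the marks
`A^T` and `A^F` become De Morgan laws. Every rule then preserves lower bounds of the premises
(`sound`), distributivity handling the discharged hypotheses, and `compact` reduces the premises to
a finite set.

For completeness, if `A` is underivable, Zorn's lemma yields a maximal theory `Θ` not deriving `A`;
the elimination rules by cases make `Θ` prime. Whether `B`, `¬B` and `∘B` belong to `Θ` allows
exactly six patterns, one for each element of `S6`, so `Θ` defines a valuation for which membership
in `Θ` means a value in the prime filter `{T, T₀, b}` (`pos_eval`). This valuation refutes the
entailment. -/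

theorem mono (h : LetfDerives Γ A) (hs : Γ ⊆ Δ) : LetfDerives Δ A := by
  induction h generalizing Δ with
  | hyp h => exact hyp (hs h)
  | andI _ _ h₁ h₂ => exact andI (h₁ hs) (h₂ hs)
  | andE₁ _ h => exact andE₁ (h hs)
  | andE₂ _ h => exact andE₂ (h hs)
  | orI₁ _ h => exact orI₁ (h hs)
  | orI₂ _ h => exact orI₂ (h hs)
  | orE _ _ _ h h₁ h₂ =>
    exact orE (h hs) (h₁ (Set.insert_subset_insert hs)) (h₂ (Set.insert_subset_insert hs))
  | negAndI₁ _ h => exact negAndI₁ (h hs)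
  | negAndI₂ _ h => exact negAndI₂ (h hs)
  | negAndE _ _ _ h h₁ h₂ =>
    exact negAndE (h hs) (h₁ (Set.insert_subset_insert hs)) (h₂ (Set.insert_subset_insert hs))
  | negOrI _ _ h₁ h₂ => exact negOrI (h₁ hs) (h₂ hs)
  | negOrE₁ _ h => exact negOrE₁ (h hs)
  | negOrE₂ _ h => exact negOrE₂ (h hs)
  | dnI _ h => exact dnI (h hs)
  | dnE _ h => exact dnE (h hs)
  | expCirc _ _ _ h h₁ h₂ => exact expCirc (h hs) (h₁ hs) (h₂ hs)
  | pemCirc _ h => exact pemCirc (h hs)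
  | circI => exact circI
  | negCircI _ h => exact negCircI (h hs)
  | negCircE _ h => exact negCircE (h hs)
  | andTI _ _ h₁ h₂ => exact andTI (h₁ hs) (h₂ hs)
  | andFI₁ _ h => exact andFI₁ (h hs)
  | andFI₂ _ h => exact andFI₂ (h hs)
  | orTI₁ _ h => exact orTI₁ (h hs)
  | orTI₂ _ h => exact orTI₂ (h hs)
  | orFI _ _ h₁ h₂ => exact orFI (h₁ hs) (h₂ hs)
  | andTE₁ _ h => exact andTE₁ (h hs)
  | andTE₂ _ h => exact andTE₂ (h hs)
  | andFE _ _ _ h h₁ h₂ =>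
    exact andFE (h hs) (h₁ (Set.insert_subset_insert hs)) (h₂ (Set.insert_subset_insert hs))
  | orTE _ _ _ h h₁ h₂ =>
    exact orTE (h hs) (h₁ (Set.insert_subset_insert hs)) (h₂ (Set.insert_subset_insert hs))
  | orFE₁ _ h => exact orFE₁ (h hs)
  | orFE₂ _ h => exact orFE₂ (h hs)
  | topI => exact topI
  | botI => exact botI

theorem cut (h : LetfDerives Γ B) (h' : LetfDerives (insert B Γ) A) : LetfDerives Γ A :=
  orE (orI₁ (B := B) h) h' h'

/-- Derivability from a finite subset of the premises. -/
def FinDerives (Γ : Set (LFormula V)) (A : LFormula V) : Prop :=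
  ∃ Δ : Set (LFormula V), Δ.Finite ∧ Δ ⊆ Γ ∧ LetfDerives Δ A

theorem FinDerives.of_empty (h : LetfDerives ∅ A) : FinDerives Γ A :=
  ⟨∅, Set.finite_empty, Set.empty_subset _, h⟩

theorem FinDerives.map (h : FinDerives Γ A)
    (f : ∀ {Δ : Set (LFormula V)}, LetfDerives Δ A → LetfDerives Δ B) : FinDerives Γ B := by
  obtain ⟨Δ, hf, hs, h⟩ := h
  exact ⟨Δ, hf, hs, f h⟩

theorem FinDerives.map₂ (h₁ : FinDerives Γ A) (h₂ : FinDerives Γ B)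
    (f : ∀ {Δ : Set (LFormula V)}, LetfDerives Δ A → LetfDerives Δ B → LetfDerives Δ C) :
    FinDerives Γ C := by
  obtain ⟨Δ₁, hf₁, hs₁, h₁⟩ := h₁
  obtain ⟨Δ₂, hf₂, hs₂, h₂⟩ := h₂
  exact ⟨Δ₁ ∪ Δ₂, hf₁.union hf₂, Set.union_subset hs₁ hs₂,
    f (h₁.mono Set.subset_union_left) (h₂.mono Set.subset_union_right)⟩

/-- Removing the discharged hypothesis from the finite set and adding it back gives one shape,
whether or not it was used. -/
theorem FinDerives.of_insert (h : FinDerives (insert A Γ) B) :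
    ∃ Δ : Set (LFormula V), Δ.Finite ∧ Δ ⊆ Γ ∧ LetfDerives (insert A Δ) B := by
  obtain ⟨Δ, hf, hs, h⟩ := h
  refine ⟨Δ \ {A}, hf.sdiff, ?_, h.mono ?_⟩
  · rintro x ⟨hx, hxA⟩
    exact (hs hx).resolve_left hxA
  · intro x hx
    by_cases hxA : x = A
    · exact Or.inl hxA
    · exact Or.inr ⟨hx, hxA⟩

theorem FinDerives.cases (h : FinDerives Γ A) (h₁ : FinDerives (insert B Γ) D)
    (h₂ : FinDerives (insert C Γ) D)
    (f : ∀ {Δ : Set (LFormula V)}, LetfDerives Δ A → LetfDerives (insert B Δ) D →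
      LetfDerives (insert C Δ) D → LetfDerives Δ D) : FinDerives Γ D := by
  obtain ⟨Δ, hf, hs, h⟩ := h
  obtain ⟨Δ₁, hf₁, hs₁, h₁⟩ := h₁.of_insert
  obtain ⟨Δ₂, hf₂, hs₂, h₂⟩ := h₂.of_insert
  refine ⟨Δ ∪ (Δ₁ ∪ Δ₂), hf.union (hf₁.union hf₂),
    Set.union_subset hs (Set.union_subset hs₁ hs₂), f (h.mono Set.subset_union_left)
      (h₁.mono (Set.insert_subset_insert ?_)) (h₂.mono (Set.insert_subset_insert ?_))⟩
  · exact Set.subset_union_left.trans Set.subset_union_right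
  · exact Set.subset_union_right.trans Set.subset_union_right

theorem compact (h : LetfDerives Γ A) : FinDerives Γ A := by
  induction h with
  | @hyp Γ A h => exact ⟨{A}, Set.finite_singleton A, Set.singleton_subset_iff.2 h, hyp rfl⟩
  | andI _ _ h₁ h₂ => exact h₁.map₂ h₂ andI
  | andE₁ _ h => exact h.map andE₁
  | andE₂ _ h => exact h.map andE₂
  | orI₁ _ h => exact h.map orI₁
  | orI₂ _ h => exact h.map orI₂
  | orE _ _ _ h h₁ h₂ => exact h.cases h₁ h₂ orE
  | negAndI₁ _ h => exact h.map negAndI₁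
  | negAndI₂ _ h => exact h.map negAndI₂
  | negAndE _ _ _ h h₁ h₂ => exact h.cases h₁ h₂ negAndE
  | negOrI _ _ h₁ h₂ => exact h₁.map₂ h₂ negOrI
  | negOrE₁ _ h => exact h.map negOrE₁
  | negOrE₂ _ h => exact h.map negOrE₂
  | dnI _ h => exact h.map dnI
  | dnE _ h => exact h.map dnE
  | expCirc _ _ _ h h₁ h₂ =>
    -- A conjunction packs two of the three premises, so that the binary combination suffices.
    exact (h.map₂ h₁ andI).map₂ h₂ fun h h' => expCirc h.andE₁ h.andE₂ h'
  | pemCirc _ h => exact h.map pemCirc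
  | circI => exact .of_empty circI
  | negCircI _ h => exact h.map negCircI
  | negCircE _ h => exact h.map negCircE
  | andTI _ _ h₁ h₂ => exact h₁.map₂ h₂ andTI
  | andFI₁ _ h => exact h.map andFI₁
  | andFI₂ _ h => exact h.map andFI₂
  | orTI₁ _ h => exact h.map orTI₁
  | orTI₂ _ h => exact h.map orTI₂
  | orFI _ _ h₁ h₂ => exact h₁.map₂ h₂ orFI
  | andTE₁ _ h => exact h.map andTE₁
  | andTE₂ _ h => exact h.map andTE₂
  | andFE _ _ _ h h₁ h₂ => exact h.cases h₁ h₂ andFE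
  | orTE _ _ _ h h₁ h₂ => exact h.cases h₁ h₂ orTE
  | orFE₁ _ h => exact h.map orFE₁
  | orFE₂ _ h => exact h.map orFE₂
  | topI => exact .of_empty topI
  | botI => exact .of_empty botI

end LetfDerives

/-! De Morgan algebras and involutive Stone algebras. -/

namespace DeMorganAlg

variable {M : Type u} [DeMorganAlg M] {x y : M}

theorem compl_le_compl (h : x ≤ y) : yᶜ ≤ xᶜ := by
  have := deMorgan x y
  rw [sup_eq_right.2 h] at this
  exact this ▸ inf_le_left

theorem compl_inf_eq (x y : M) : (x ⊓ y)ᶜ = xᶜ ⊔ yᶜ := by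
  rw [← invol (xᶜ ⊔ yᶜ), deMorgan, invol, invol]

theorem compl_bot_eq : (⊥ : M)ᶜ = ⊤ := by
  have h : (⊤ : M)ᶜᶜ ≤ ⊥ᶜ := compl_le_compl bot_le
  rw [invol] at h
  exact top_le_iff.1 h

theorem compl_top_eq : (⊤ : M)ᶜ = ⊥ := by
  rw [← compl_bot_eq, invol]

theorem sup_compl_eq_top (h : xᶜ ⊓ x = ⊥) : xᶜ ⊔ x = ⊤ := by
  rw [← invol (xᶜ ⊔ x), deMorgan, invol, inf_comm, h, compl_bot_eq]

end DeMorganAlg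

namespace IsNabla

open DeMorganAlg

variable {M : Type u} [DeMorganAlg M] {nab : M → M} {x y : M}

theorem le_nabla (h : IsNabla nab) (x : M) : x ≤ nab x := inf_eq_left.1 (h.inf_self x)

theorem monotone (h : IsNabla nab) (hxy : x ≤ y) : nab x ≤ nab y := by
  have := h.map_inf x y
  rw [inf_eq_left.2 hxy] at this
  exact inf_eq_left.1 this.symm

/-- Such an `x` is complemented by `¬x`. As `∇x ∧ ¬x ≤ ∇x ∧ ∇¬x = ∇⊥ = ⊥`, splitting `∇x` along `¬x
∨ x` leaves only `∇x ∧ x`. -/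
theorem eq_self_of_compl_inf (h : IsNabla nab) (hx : xᶜ ⊓ x = ⊥) : nab x = x := by
  refine le_antisymm ?_ (h.le_nabla x)
  have h₁ : nab x ⊓ xᶜ = ⊥ := by
    refine le_bot_iff.1 ((inf_le_inf_left _ (h.le_nabla xᶜ)).trans ?_)
    rw [← h.map_inf, inf_comm, hx, h.map_bot]
  calc nab x = nab x ⊓ (xᶜ ⊔ x) := by rw [sup_compl_eq_top hx, inf_top_eq]
    _ = nab x ⊓ x := by rw [inf_sup_left, h₁, bot_sup_eq]
    _ ≤ x := inf_le_right

/-- The element `∇x ∨ ∇y` is complemented, hence fixed by `∇`, and it lies above `x ∨ y`. -/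
theorem map_sup (h : IsNabla nab) (x y : M) : nab (x ⊔ y) = nab x ⊔ nab y := by
  refine le_antisymm ?_ (sup_le (h.monotone le_sup_left) (h.monotone le_sup_right))
  have hc : (nab x ⊔ nab y)ᶜ ⊓ (nab x ⊔ nab y) = ⊥ := by
    rw [deMorgan, inf_sup_left, inf_right_comm, h.compl_inf, inf_assoc, h.compl_inf]
    simp
  exact (h.monotone (sup_le_sup (h.le_nabla x) (h.le_nabla y))).trans
    (h.eq_self_of_compl_inf hc).le

end IsNabla

namespace InvStoneCircAlg

open DeMorganAlg

variable {M : Type u} [InvStoneCircAlg M]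

/-- The operator `∇x = x ∨ ¬∘x`. -/
def nab (x : M) : M := x ⊔ (circ x)ᶜ

theorem isNabla_nab : IsNabla (nab : M → M) := isNabla

theorem circ_eq_nab (x : M) : circ x = (nab x)ᶜ ⊔ (nab xᶜ)ᶜ := circ_eq x

theorem compl_nab_le (x : M) : (nab x)ᶜ ≤ xᶜ := compl_le_compl (isNabla_nab.le_nabla x)

theorem compl_nab_compl_le (x : M) : (nab xᶜ)ᶜ ≤ x := by
  simpa only [invol] using compl_nab_le xᶜ

theorem circ_compl (x : M) : circ xᶜ = circ x := by
  rw [circ_eq_nab, circ_eq_nab, invol, sup_comm]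

/-- Of the two joinands of `∘x`, `¬∇x` is disjoint from `x` and `¬∇¬x` lies below it. -/
theorem circ_inf_self (x : M) : circ x ⊓ x = (nab xᶜ)ᶜ := by
  have h : (nab x)ᶜ ⊓ x = ⊥ := le_bot_iff.1
    ((inf_le_inf_left _ (isNabla_nab.le_nabla x)).trans (isNabla_nab.compl_inf x).le)
  rw [circ_eq_nab, inf_sup_right, h, bot_sup_eq, inf_eq_left.2 (compl_nab_compl_le x)]

theorem circ_inf_compl (x : M) : circ x ⊓ xᶜ = (nab x)ᶜ := by
  rw [← circ_compl, circ_inf_self, invol]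

theorem circ_inf_inf_compl (x : M) : circ x ⊓ x ⊓ xᶜ = ⊥ := by
  rw [circ_inf_self]
  exact le_bot_iff.1 ((inf_le_inf_left _ (isNabla_nab.le_nabla xᶜ)).trans
    (isNabla_nab.compl_inf xᶜ).le)

theorem circ_le (x : M) : circ x ≤ x ⊔ xᶜ := by
  rw [circ_eq_nab, sup_comm x]
  exact sup_le_sup (compl_nab_le x) (compl_nab_compl_le x)

theorem circ_eq_top {x : M} (hx : xᶜ ⊓ x = ⊥) : circ x = ⊤ := by
  have hx' : xᶜᶜ ⊓ xᶜ = ⊥ := by rw [invol, inf_comm, hx]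
  rw [circ_eq_nab, isNabla_nab.eq_self_of_compl_inf hx, isNabla_nab.eq_self_of_compl_inf hx',
    invol, sup_compl_eq_top hx]

/-- The negation of `∘x` is `∇x ∧ ∇¬x`, which is disjoint from both joinands of `∘x`; so `∘x` is
complemented. -/
theorem circ_circ (x : M) : circ (circ x) = ⊤ := by
  apply circ_eq_top
  have h₁ := isNabla_nab.compl_inf x
  have h₂ := isNabla_nab.compl_inf xᶜ
  rw [circ_eq_nab, deMorgan, invol, invol, inf_sup_left, inf_right_comm, inf_comm (nab x), h₁,
    inf_assoc, inf_comm (nab xᶜ), h₂]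
  simp

theorem markT_inf (x y : M) :
    circ (x ⊓ y) ⊓ (x ⊓ y) = (circ x ⊓ x) ⊓ (circ y ⊓ y) := by
  simp only [circ_inf_self, compl_inf_eq, isNabla_nab.map_sup, deMorgan]

theorem markF_inf (x y : M) :
    circ (x ⊓ y) ⊓ (x ⊓ y)ᶜ = (circ x ⊓ xᶜ) ⊔ (circ y ⊓ yᶜ) := by
  rw [circ_inf_compl, circ_inf_compl, circ_inf_compl, isNabla_nab.map_inf, compl_inf_eq]

theorem markT_sup (x y : M) :
    circ (x ⊔ y) ⊓ (x ⊔ y) = (circ x ⊓ x) ⊔ (circ y ⊓ y) := by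
  simp only [circ_inf_self, compl_inf_eq, isNabla_nab.map_inf, deMorgan]

theorem markF_sup (x y : M) :
    circ (x ⊔ y) ⊓ (x ⊔ y)ᶜ = (circ x ⊓ xᶜ) ⊓ (circ y ⊓ yᶜ) := by
  rw [circ_inf_compl, circ_inf_compl, circ_inf_compl, isNabla_nab.map_sup, deMorgan]

theorem markF_bot : circ (⊥ : M) ⊓ ⊥ᶜ = ⊤ := by
  rw [circ_inf_compl, isNabla_nab.map_bot, compl_bot_eq]

theorem markT_top : circ (⊤ : M) ⊓ ⊤ = ⊤ := by
  rw [circ_inf_self, compl_top_eq, isNabla_nab.map_bot, compl_bot_eq]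

end InvStoneCircAlg

/-! Soundness. -/

namespace LetfDerives

open DeMorganAlg InvStoneCircAlg LFormula

variable {V : Type v}

/-- By distributivity `m` is the join of `m ∧ e B` and `m ∧ e C`, each a lower bound of the premises
extended by its own case. -/
theorem le_of_le_sup_of_insert {M : Type u} [DistribLattice M] {Γ : Set (LFormula V)}
    {e : LFormula V → M} {B C : LFormula V} {m c : M} (hm : ∀ A ∈ Γ, m ≤ e A)
    (h : m ≤ e B ⊔ e C) (h₁ : ∀ m' : M, (∀ A ∈ insert B Γ, m' ≤ e A) → m' ≤ c)
    (h₂ : ∀ m' : M, (∀ A ∈ insert C Γ, m' ≤ e A) → m' ≤ c) : m ≤ c := by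
  rw [← inf_eq_left.2 h, inf_sup_left]
  refine sup_le (h₁ _ ?_) (h₂ _ ?_) <;>
  · rintro A (rfl | hA)
    · exact inf_le_right
    · exact inf_le_left.trans (hm A hA)

/-- An arbitrary lower bound `m` replaces the meet of `Γ`, which need not exist; it must vary
because case rules shrink it. -/
theorem sound {Γ : Set (LFormula V)} {A : LFormula V} (h : LetfDerives Γ A) {M : Type u}
    [InvStoneCircAlg M] (w : V → M) (m : M) (hm : ∀ B ∈ Γ, m ≤ B.eval w) : m ≤ A.eval w := by
  induction h generalizing m with
  | hyp h => exact hm _ h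
  | andI _ _ h₁ h₂ => exact le_inf (h₁ m hm) (h₂ m hm)
  | andE₁ _ h => exact (h m hm).trans inf_le_left
  | andE₂ _ h => exact (h m hm).trans inf_le_right
  | orI₁ _ h => exact (h m hm).trans le_sup_left
  | orI₂ _ h => exact (h m hm).trans le_sup_right
  | orE _ _ _ h h₁ h₂ => exact le_of_le_sup_of_insert hm (h m hm) h₁ h₂
  | negAndI₁ _ h => exact (h m hm).trans (compl_le_compl inf_le_left)
  | negAndI₂ _ h => exact (h m hm).trans (compl_le_compl inf_le_right)
  | negAndE _ _ _ h h₁ h₂ =>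
    exact le_of_le_sup_of_insert hm ((h m hm).trans (compl_inf_eq _ _).le) h₁ h₂
  | negOrI _ _ h₁ h₂ => exact (le_inf (h₁ m hm) (h₂ m hm)).trans (deMorgan _ _).ge
  | negOrE₁ _ h => exact (h m hm).trans (compl_le_compl le_sup_left)
  | negOrE₂ _ h => exact (h m hm).trans (compl_le_compl le_sup_right)
  | dnI _ h => exact (h m hm).trans (invol _).ge
  | dnE _ h => exact (h m hm).trans (invol _).le
  | expCirc _ _ _ h h₁ h₂ =>
    exact (le_inf (le_inf (h m hm) (h₁ m hm)) (h₂ m hm)).trans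
      ((circ_inf_inf_compl _).le.trans bot_le)
  | pemCirc _ h => exact (h m hm).trans (circ_le _)
  | circI => exact le_top.trans (circ_circ _).ge
  | negCircI _ h => exact (h m hm).trans (circ_compl _).ge
  | negCircE _ h => exact (h m hm).trans (circ_compl _).le
  | andTI _ _ h₁ h₂ => exact (le_inf (h₁ m hm) (h₂ m hm)).trans (markT_inf _ _).ge
  | andFI₁ _ h => exact ((h m hm).trans le_sup_left).trans (markF_inf _ _).ge
  | andFI₂ _ h => exact ((h m hm).trans le_sup_right).trans (markF_inf _ _).ge
  | orTI₁ _ h => exact ((h m hm).trans le_sup_left).trans (markT_sup _ _).ge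
  | orTI₂ _ h => exact ((h m hm).trans le_sup_right).trans (markT_sup _ _).ge
  | orFI _ _ h₁ h₂ => exact (le_inf (h₁ m hm) (h₂ m hm)).trans (markF_sup _ _).ge
  | andTE₁ _ h => exact ((h m hm).trans (markT_inf _ _).le).trans inf_le_left
  | andTE₂ _ h => exact ((h m hm).trans (markT_inf _ _).le).trans inf_le_right
  | andFE _ _ _ h h₁ h₂ =>
    exact le_of_le_sup_of_insert hm ((h m hm).trans (markF_inf _ _).le) h₁ h₂
  | orTE _ _ _ h h₁ h₂ =>
    exact le_of_le_sup_of_insert hm ((h m hm).trans (markT_sup _ _).le) h₁ h₂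
  | orFE₁ _ h => exact ((h m hm).trans (markF_sup _ _).le).trans inf_le_left
  | orFE₂ _ h => exact ((h m hm).trans (markF_sup _ _).le).trans inf_le_right
  | topI => exact le_top.trans markT_top.ge
  | botI => exact le_top.trans markF_bot.ge

/-- A derivable formula is a theorem, or lies above the meet of finitely many premises, uniformly
over any class of algebras. -/
theorem sound_finset {Γ : Set (LFormula V)} {A : LFormula V} (h : LetfDerives Γ A) :
    (∀ (M : Type u) [InvStoneCircAlg M] (w : V → M), A.eval w = ⊤) ∨
      ∃ Δ : Finset (LFormula V), Δ.Nonempty ∧ (∀ B ∈ Δ, B ∈ Γ) ∧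
        ∀ (M : Type u) [InvStoneCircAlg M] (w : V → M),
          (Δ.inf fun B => B.eval w) ≤ A.eval w := by
  obtain ⟨Δ, hf, hs, h⟩ := h.compact
  lift Δ to Finset (LFormula V) using hf
  rcases Δ.eq_empty_or_nonempty with rfl | hne
  -- With no premises `⊤` itself is a lower bound, which gives the alternative that `A` is valid.
  · exact Or.inl fun M _ w => top_le_iff.1 (h.sound w ⊤ (by simp))
  · exact Or.inr ⟨Δ, hne, hs, fun M _ w =>
      h.sound w _ fun B hB => Finset.inf_le (f := fun B => B.eval w) hB⟩

end LetfDerives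

/-! Completeness. -/

/-- Theories that are maximal among those not deriving `A`. -/
structure IsMaximalTheory {V : Type v} (A : LFormula V) (Θ : Set (LFormula V)) : Prop where
  not_derives : ¬ LetfDerives Θ A
  derives_insert : ∀ B, B ∉ Θ → LetfDerives (insert B Θ) A

/-- Zorn's lemma applies because a derivation uses finitely many premises: one from the union of a
chain already lives in a member of it. -/
theorem exists_isMaximalTheory {V : Type v} {Γ : Set (LFormula V)} {A : LFormula V}
    (h : ¬ LetfDerives Γ A) : ∃ Θ, Γ ⊆ Θ ∧ IsMaximalTheory A Θ := by
  obtain ⟨Θ, hΓ, hmax⟩ := zorn_subset_nonempty {Θ | ¬ LetfDerives Θ A} (by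
    intro c hc hchain hne
    refine ⟨⋃₀ c, fun hder => ?_, fun s hs => Set.subset_sUnion_of_mem hs⟩
    obtain ⟨Δ, hf, hs, hder⟩ := LetfDerives.compact hder
    obtain ⟨t, ht, hΔt⟩ :=
      DirectedOn.exists_mem_subset_of_finite_of_subset_sUnion hne hchain.directedOn hf hs
    exact hc ht (hder.mono hΔt)) Γ h
  refine ⟨Θ, hΓ, hmax.prop, fun B hB => ?_⟩
  by_contra hn
  exact hB (hmax.le_of_ge hn (Set.subset_insert B Θ) (Set.mem_insert B Θ))

namespace IsMaximalTheory

open LFormula LetfDerives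

variable {V : Type v} {A : LFormula V} {Θ : Set (LFormula V)} {B C : LFormula V}

theorem mem_of_derives (h : IsMaximalTheory A Θ) (hB : LetfDerives Θ B) : B ∈ Θ := by
  by_contra hn
  exact h.not_derives (hB.cut (h.derives_insert B hn))

/-- Elimination by cases makes a maximal theory prime. -/
theorem mem_or_mem (h : IsMaximalTheory A Θ)
    (hE : LetfDerives (insert B Θ) A → LetfDerives (insert C Θ) A → LetfDerives Θ A) :
    B ∈ Θ ∨ C ∈ Θ := by
  by_contra! hn
  exact h.not_derives (hE (h.derives_insert B hn.1) (h.derives_insert C hn.2))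

theorem and_mem (h : IsMaximalTheory A Θ) : and B C ∈ Θ ↔ B ∈ Θ ∧ C ∈ Θ :=
  ⟨fun hm => ⟨h.mem_of_derives (andE₁ (hyp hm)), h.mem_of_derives (andE₂ (hyp hm))⟩,
    fun hm => h.mem_of_derives (andI (hyp hm.1) (hyp hm.2))⟩

theorem or_mem (h : IsMaximalTheory A Θ) : or B C ∈ Θ ↔ B ∈ Θ ∨ C ∈ Θ :=
  ⟨fun hm => h.mem_or_mem (orE (hyp hm)), fun hm => h.mem_of_derives <|
    hm.elim (fun hm => orI₁ (hyp hm)) (fun hm => orI₂ (hyp hm))⟩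

theorem neg_and_mem (h : IsMaximalTheory A Θ) : neg (and B C) ∈ Θ ↔ neg B ∈ Θ ∨ neg C ∈ Θ :=
  ⟨fun hm => h.mem_or_mem (negAndE (hyp hm)), fun hm => h.mem_of_derives <|
    hm.elim (fun hm => negAndI₁ (hyp hm)) (fun hm => negAndI₂ (hyp hm))⟩

theorem neg_or_mem (h : IsMaximalTheory A Θ) : neg (or B C) ∈ Θ ↔ neg B ∈ Θ ∧ neg C ∈ Θ :=
  ⟨fun hm => ⟨h.mem_of_derives (negOrE₁ (hyp hm)), h.mem_of_derives (negOrE₂ (hyp hm))⟩,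
    fun hm => h.mem_of_derives (negOrI (hyp hm.1) (hyp hm.2))⟩

theorem neg_neg_mem (h : IsMaximalTheory A Θ) : neg (neg B) ∈ Θ ↔ B ∈ Θ :=
  ⟨fun hm => h.mem_of_derives (dnE (hyp hm)), fun hm => h.mem_of_derives (dnI (hyp hm))⟩

theorem circ_neg_mem (h : IsMaximalTheory A Θ) : circ (neg B) ∈ Θ ↔ circ B ∈ Θ :=
  ⟨fun hm => h.mem_of_derives (negCircE (hyp hm)),
    fun hm => h.mem_of_derives (negCircI (hyp hm))⟩

theorem circ_circ_mem (h : IsMaximalTheory A Θ) : circ (circ B) ∈ Θ := h.mem_of_derives circI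

/-- Explosion excludes having both `B` and `¬B`; excluded middle with primeness excludes having
neither. -/
theorem neg_mem_iff_of_circ_mem (h : IsMaximalTheory A Θ) (hB : circ B ∈ Θ) :
    neg B ∈ Θ ↔ B ∉ Θ :=
  ⟨fun hn hm => h.not_derives (expCirc (hyp hB) (hyp hm) (hyp hn)), fun hn =>
    (h.or_mem.1 (h.mem_of_derives (pemCirc (hyp hB)))).resolve_left hn⟩

theorem neg_circ_mem (h : IsMaximalTheory A Θ) : neg (circ B) ∈ Θ ↔ circ B ∉ Θ :=
  h.neg_mem_iff_of_circ_mem h.circ_circ_mem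

theorem markT_and_mem (h : IsMaximalTheory A Θ) :
    markT (and B C) ∈ Θ ↔ markT B ∈ Θ ∧ markT C ∈ Θ :=
  ⟨fun hm => ⟨h.mem_of_derives (andTE₁ (hyp hm)), h.mem_of_derives (andTE₂ (hyp hm))⟩,
    fun hm => h.mem_of_derives (andTI (hyp hm.1) (hyp hm.2))⟩

theorem markF_and_mem (h : IsMaximalTheory A Θ) :
    markF (and B C) ∈ Θ ↔ markF B ∈ Θ ∨ markF C ∈ Θ :=
  ⟨fun hm => h.mem_or_mem (andFE (hyp hm)), fun hm => h.mem_of_derives <|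
    hm.elim (fun hm => andFI₁ (hyp hm)) (fun hm => andFI₂ (hyp hm))⟩

theorem markT_or_mem (h : IsMaximalTheory A Θ) :
    markT (or B C) ∈ Θ ↔ markT B ∈ Θ ∨ markT C ∈ Θ :=
  ⟨fun hm => h.mem_or_mem (orTE (hyp hm)), fun hm => h.mem_of_derives <|
    hm.elim (fun hm => orTI₁ (hyp hm)) (fun hm => orTI₂ (hyp hm))⟩

theorem markF_or_mem (h : IsMaximalTheory A Θ) :
    markF (or B C) ∈ Θ ↔ markF B ∈ Θ ∧ markF C ∈ Θ :=
  ⟨fun hm => ⟨h.mem_of_derives (orFE₁ (hyp hm)), h.mem_of_derives (orFE₂ (hyp hm))⟩,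
    fun hm => h.mem_of_derives (orFI (hyp hm.1) (hyp hm.2))⟩

theorem markT_mem (h : IsMaximalTheory A Θ) : markT B ∈ Θ ↔ circ B ∈ Θ ∧ B ∈ Θ := h.and_mem

theorem markF_mem (h : IsMaximalTheory A Θ) : markF B ∈ Θ ↔ circ B ∈ Θ ∧ B ∉ Θ :=
  h.and_mem.trans (and_congr_right fun hB => h.neg_mem_iff_of_circ_mem hB)

theorem top_mem (h : IsMaximalTheory A Θ) : circ top ∈ Θ ∧ top ∈ Θ :=
  h.markT_mem.1 (h.mem_of_derives topI)

theorem bot_mem (h : IsMaximalTheory A Θ) : circ bot ∈ Θ ∧ bot ∉ Θ :=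
  h.markF_mem.1 (h.mem_of_derives botI)

end IsMaximalTheory

/-! ### The prime filter of designated values -/

namespace S6

/-- The designated values `T`, `T₀`, `b`. -/
def pos : S6 → Bool
  | T | T₀ | b => true
  | _ => false

theorem pos_inf : ∀ x y : S6, pos (x ⊓ y) = (pos x && pos y) := by decide

theorem pos_mono {x y : S6} (h : x ≤ y) (hx : pos x = true) : pos y = true := by
  rw [← inf_eq_left.2 h, pos_inf, Bool.and_eq_true] at hx
  exact hx.2

theorem pos_sup : ∀ x y : S6, pos (x ⊔ y) = (pos x || pos y) := by decide

theorem pos_finset_inf {ι : Type*} (s : Finset ι) (f : ι → S6) (h : ∀ i ∈ s, pos (f i) = true) :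
    pos (s.inf f) = true := by
  classical
  induction s using Finset.induction_on with
  | empty => rfl
  | insert a s _ ih =>
    rw [Finset.inf_insert, pos_inf, h a (Finset.mem_insert_self a s),
      ih fun i hi => h i (Finset.mem_insert_of_mem hi), Bool.and_self]

/-- The value with given designation of `x`, `¬x` and `∘x`. -/
def ofDesignation : Bool → Bool → Bool → S6
  | true, _, true => T
  | false, _, true => F
  | true, true, false => b
  | true, false, false => T₀
  | false, true, false => F₀
  | false, false, false => n

/-- The side condition mirrors `neg_mem_iff_of_circ_mem` and leaves six of the eight patterns, one
per value. -/
theorem pos_ofDesignation : ∀ p q c : Bool, (c = true → q = !p) →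
    pos (ofDesignation p q c) = p ∧ pos (ofDesignation p q c)ᶜ = q ∧
      pos (InvStoneCircAlg.circ (ofDesignation p q c)) = c := by decide

/-- The value `∘z` is designated only for `z = T` and `z = F`, and `z` itself being designated
separates these. A meet is `T` when both arguments are, and `F` when one of them is, since `F₀` lies
below every other nonzero element. -/
theorem pos_circ_inf : ∀ x y : S6, pos (InvStoneCircAlg.circ (x ⊓ y)) =
    ((pos (InvStoneCircAlg.circ x) && pos x && (pos (InvStoneCircAlg.circ y) && pos y)) ||
      ((pos (InvStoneCircAlg.circ x) && !pos x) ||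
        (pos (InvStoneCircAlg.circ y) && !pos y))) := by decide

theorem pos_circ_sup : ∀ x y : S6, pos (InvStoneCircAlg.circ (x ⊔ y)) =
    (((pos (InvStoneCircAlg.circ x) && pos x) || (pos (InvStoneCircAlg.circ y) && pos y)) ||
      ((pos (InvStoneCircAlg.circ x) && !pos x) &&
        (pos (InvStoneCircAlg.circ y) && !pos y))) := by decide

theorem pos_compl_circ : ∀ x : S6, pos (InvStoneCircAlg.circ x)ᶜ =
    !pos (InvStoneCircAlg.circ x) := by decide

theorem pos_circ_circ : ∀ x : S6,
    pos (InvStoneCircAlg.circ (InvStoneCircAlg.circ x)) = true := by decide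

theorem pos_circ_compl : ∀ x : S6, pos (InvStoneCircAlg.circ xᶜ) =
    pos (InvStoneCircAlg.circ x) := by decide

end S6

/-! ### Canonical valuation and truth lemma -/

namespace IsMaximalTheory

open LFormula LetfDerives

variable {V : Type v} {A : LFormula V} {Θ : Set (LFormula V)} {B C : LFormula V}

/-- The rules govern `∘` of a conjunction or disjunction only through the marks, so `∘B` is split
into them. -/
theorem circ_mem (h : IsMaximalTheory A Θ) : circ B ∈ Θ ↔ markT B ∈ Θ ∨ markF B ∈ Θ := by
  rw [h.markT_mem, h.markF_mem]
  tauto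

open Classical in
/-- The canonical valuation of a maximal theory. -/
noncomputable def valuation (Θ : Set (LFormula V)) (p : V) : S6 :=
  S6.ofDesignation (var p ∈ Θ) (neg (var p) ∈ Θ) (circ (var p) ∈ Θ)

/-- The three claims need a joint induction: the clauses for `¬` and `∘` of a compound refer to `¬`
and `∘` of its parts. -/
theorem pos_eval (h : IsMaximalTheory A Θ) (B : LFormula V) :
    (S6.pos (B.eval (valuation Θ)) = true ↔ B ∈ Θ) ∧
      (S6.pos (B.eval (valuation Θ))ᶜ = true ↔ neg B ∈ Θ) ∧
      (S6.pos (InvStoneCircAlg.circ (B.eval (valuation Θ))) = true ↔ circ B ∈ Θ) := by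
  classical
  induction B with
  | var p =>
    obtain ⟨h₁, h₂, h₃⟩ := S6.pos_ofDesignation (decide (var p ∈ Θ)) (decide (neg (var p) ∈ Θ))
      (decide (circ (var p) ∈ Θ)) (fun hc => by
        have := h.neg_mem_iff_of_circ_mem (of_decide_eq_true hc)
        simp [this])
    simp only [eval, valuation]
    refine ⟨?_, ?_, ?_⟩
    · convert decide_eq_true_iff (p := var p ∈ Θ) using 2
    · convert decide_eq_true_iff (p := neg (var p) ∈ Θ) using 2
    · convert decide_eq_true_iff (p := circ (var p) ∈ Θ) using 2
  | top =>
    have ht := h.top_mem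
    have hn := h.neg_mem_iff_of_circ_mem ht.1
    exact ⟨iff_of_true rfl ht.2, iff_of_false Bool.false_ne_true (by tauto), iff_of_true rfl ht.1⟩
  | bot =>
    have ht := h.bot_mem
    have hn := h.neg_mem_iff_of_circ_mem ht.1
    exact ⟨iff_of_false Bool.false_ne_true ht.2, iff_of_true rfl (by tauto), iff_of_true rfl ht.1⟩
  | neg B ih =>
    simp only [eval, DeMorganAlg.invol, S6.pos_circ_compl, h.neg_neg_mem, h.circ_neg_mem]
    exact ⟨ih.2.1, ih.1, ih.2.2⟩
  | circ B ih =>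
    simp only [eval, S6.pos_compl_circ, S6.pos_circ_circ, h.neg_circ_mem, h.circ_circ_mem,
      ← ih.2.2]
    simp
  | and B C ihB ihC =>
    simp only [eval, DeMorganAlg.compl_inf_eq, S6.pos_inf, S6.pos_sup, S6.pos_circ_inf,
      h.and_mem, h.neg_and_mem, h.circ_mem (B := and B C), h.markT_and_mem, h.markF_and_mem,
      h.markT_mem, h.markF_mem, ← ihB.1, ← ihC.1, ← ihB.2.1, ← ihC.2.1, ← ihB.2.2, ← ihC.2.2]
    simp
  | or B C ihB ihC =>
    simp only [eval, DeMorganAlg.deMorgan, S6.pos_inf, S6.pos_sup, S6.pos_circ_sup,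
      h.or_mem, h.neg_or_mem, h.circ_mem (B := or B C), h.markT_or_mem, h.markF_or_mem,
      h.markT_mem, h.markF_mem, ← ihB.1, ← ihC.1, ← ihB.2.1, ← ihC.2.1, ← ihB.2.2, ← ihC.2.2]
    simp

end IsMaximalTheory

/-- Under the canonical valuation all premises are designated; the filter is closed under finite
meets and upwards, which would put `A` into `Θ`. -/
theorem S6DegreeEntails.derives {V : Type v} {Γ : Set (LFormula V)} {A : LFormula V}
    (hA : S6DegreeEntails Γ A) : LetfDerives Γ A := by
  by_contra hn
  obtain ⟨Θ, hΓ, h⟩ := exists_isMaximalTheory hn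
  refine h.not_derives (.hyp ((h.pos_eval A).1.1 ?_))
  rcases hA with hA | ⟨Δ, -, hΔ, hA⟩
  · rw [hA]
    rfl
  · exact S6.pos_mono (hA _)
      (S6.pos_finset_inf _ _ fun B hB => (h.pos_eval B).1.2 (hΓ (hΔ B hB)))

/-! Transfer of `S6` to an arbitrary universe. -/

namespace ULift

variable {M : Type v}

instance [DeMorganAlg M] : DeMorganAlg (ULift.{u} M) where
  __ := (inferInstance : BoundedOrder (ULift.{u} M))
  __ := (inferInstance : Compl (ULift.{u} M))
  le_sup_inf x y z := le_sup_inf (x := x.down) (y := y.down) (z := z.down)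
  invol x := ULift.ext _ _ (DeMorganAlg.invol x.down)
  deMorgan x y := ULift.ext _ _ (DeMorganAlg.deMorgan x.down y.down)

instance [InvStoneCircAlg M] : InvStoneCircAlg (ULift.{u} M) where
  circ x := ⟨InvStoneCircAlg.circ x.down⟩
  isNabla :=
    have h := InvStoneCircAlg.isNabla (M := M)
    { map_bot := ULift.ext _ _ h.map_bot
      inf_self := fun x => ULift.ext _ _ (h.inf_self x.down)
      map_inf := fun x y => ULift.ext _ _ (h.map_inf x.down y.down)
      compl_inf := fun x => ULift.ext _ _ (h.compl_inf x.down) }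
  circ_eq x := ULift.ext _ _ (InvStoneCircAlg.circ_eq x.down)

end ULift

theorem LFormula.eval_up {V : Type v} {M : Type*} [InvStoneCircAlg M] (w : V → M)
    (A : LFormula V) : A.eval (fun p => ULift.up.{u} (w p)) = ULift.up (A.eval w) := by
  induction A with
  | var | top | bot => rfl
  | neg _ ih | circ _ ih => simp only [eval, ih]; rfl
  | and _ _ ih₁ ih₂ | or _ _ ih₁ ih₂ => simp only [eval, ih₁, ih₂]; rfl

theorem IsaDegreeEntails.s6DegreeEntails {V : Type v} {Γ : Set (LFormula V)} {A : LFormula V}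
    (h : IsaDegreeEntails.{u} Γ A) : S6DegreeEntails Γ A := by
  rcases h with h | ⟨Δ, hne, hΔ, h⟩
  · left
    intro w
    have := h (ULift.{u} S6) fun p => ⟨w p⟩
    rw [LFormula.eval_up] at this
    exact congrArg ULift.down this
  · refine Or.inr ⟨Δ, hne, hΔ, fun w => ?_⟩
    have := h (ULift.{u} S6) fun p => ⟨w p⟩
    simp only [LFormula.eval_up] at this
    -- Lifting commutes with finite meets; only this inequality is needed.
    have hle : ULift.up.{u} (Δ.inf fun B => B.eval w) ≤ Δ.inf fun B => ULift.up (B.eval w) :=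
      Finset.le_inf fun B hB =>
        ULift.up_le.2 (Finset.inf_le (f := fun B => B.eval w) hB)
    exact ULift.up_le.1 (hle.trans this)

theorem LetfDerives.isaDegreeEntails {V : Type v} {Γ : Set (LFormula V)} {A : LFormula V}
    (h : LetfDerives Γ A) : IsaDegreeEntails.{u} Γ A := h.sound_finset

theorem mainTheorem10 {V : Type v} [Countable V] [Infinite V]
    (Γ : Set (LFormula V)) (A : LFormula V) :
    (LetfDerives Γ A ↔ IsaDegreeEntails.{u, v} Γ A) ∧
      (LetfDerives Γ A ↔ S6DegreeEntails Γ A) :=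
  ⟨⟨fun h => h.isaDegreeEntails, fun h => h.s6DegreeEntails.derives⟩,
    -- Any universe level would serve for this passage through the variety.
    ⟨fun h => (LetfDerives.isaDegreeEntails.{0} h).s6DegreeEntails, fun h => h.derives⟩⟩
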